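/- Let $\Phi=(\Gamma,\phi)$ be a $\mathbb{T}$-gain graph on a finite connected simple graph $\Gamma=(V,E)$ with vertices $v_1,\dots,v_n$: $\phi$ assigns to every oriented edge $e_{ij}$ a complex number of absolute value $1$, with $\phi(e_{ij})=\phi(e_{ji})^{-1}$. Let $A(\Phi)$ be the Hermitian matrix with $(i,j)$ entry $\phi(e_{ij})$ if $v_i$ and $v_j$ are adjacent and $0$ otherwise, let $D(\Gamma)$ be the diagonal matrix of vertex degrees, and let $L(\Phi)=D(\Gamma)-A(\Phi)$. Let $(\Gamma,-1)$ be the gain graph on $\Gamma$ with all gains $-1$, and let $Q(\Gamma)=D(\Gamma)+A(\Gamma)=L(\Gamma,-1)$ be the signless Laplacian. Write $\Phi\sim(\Gamma,-1)$ if there is $\zeta:V\to\mathbb{T}$ with $\zeta(v_i)^{-1}\phi(e_{ij})\zeta(v_j)=-1$ for all oriented edges $e_{ij}$. Let $\lambda_1$ denote the largest eigenvalue, $d_i$ the degree of $v_i$, $\Delta=\max_i d_i$, and $m_i=\frac{1}{d_i}\sum_{v_k\sim v_i}d_k$ the average 2-degree (with $m_i=0$ if $d_i=0$, which happens only when $n=1$).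 Then the following hold. (1) Bounds that are maxima over the vertices: \begin{align*} \lambda_1(L(\Phi))&\le 2\Delta,\\ \lambda_1(L(\Phi))&\le \max_i\{d_i+m_i\},\\ \lambda_1(L(\Phi))&\le \max_i\{d_i+\sqrt{d_im_i}\},\\ \lambda_1(L(\Phi))&\le \max_i\sqrt{2d_i(d_i+m_i)},\\ \lambda_1(L(\Phi))&\le \max_i\frac{d_i+\sqrt{d_i^2+8d_im_i}}{2}. \end{align*} (2) If $\Gamma$ has at least one edge, bounds that are maxima over the edges: \begin{align*} \lambda_1(L(\Phi))&\le \max_{e_{ij}\in E}\{d_i+d_j\},\\ \lambda_1(L(\Phi))&\le \max_{e_{ij}\in E}\frac{d_i(d_i+m_i)+d_j(d_j+m_j)}{d_i+d_j},\\ \lambda_1(L(\Phi))&\le \max_{e_{ij}\in E}\sqrt{d_i(d_i+m_i)+d_j(d_j+m_j)},\\ \lambda_1(L(\Phi))&\le \max_{e_{ij}\in E}\left\{2+\sqrt{d_i(d_i+m_i-4)+d_j(d_j+m_j-4)+4}\right\},\\ \lambda_1(L(\Phi))&\le \max_{e_{ij}\in E}\frac{d_i+d_j+\sqrt{(d_i-d_j)^2+4m_im_j}}{2}.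 \end{align*} (3) Equality: $\lambda_1(L(\Phi))\le\lambda_1(Q(\Gamma))$, with equality if and only if $\Phi\sim(\Gamma,-1)$. Moreover, for each of the bounds above, with right-hand side $B(\Gamma)$, equality $\lambda_1(L(\Phi))=B(\Gamma)$ holds if and only if $\Phi\sim(\Gamma,-1)$ and $\lambda_1(Q(\Gamma))=B(\Gamma)$. In particular, equality in any one of the bounds forces $\Phi\sim(\Gamma,-1)$, and if the bound is attained by $Q(\Gamma)$ then equality holds if and only if $\Phi\sim(\Gamma,-1)$. -/

import Mathlib

/-- A `𝕋`-gain graph with underlying simple graph `Γ`: every oriented edge carries a complex unit,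
and the two orientations of an edge carry inverse units. -/
structure TGainGraph {V : Type*} (Γ : SimpleGraph V) where
  gain : Γ.Dart → Circle
  gain_symm : ∀ e : Γ.Dart, gain e.symm = (gain e)⁻¹

namespace TGainGraph

variable {V : Type*} {Γ : SimpleGraph V}

/-- Switching by `ζ : V → 𝕋` replaces `φ(e_ij)` by `ζ(v_i)⁻¹ φ(e_ij) ζ(v_j)`. -/
noncomputable def switch (Φ : TGainGraph Γ) (ζ : V → Circle) : TGainGraph Γ where
  gain e := (ζ e.fst)⁻¹ * Φ.gain e * ζ e.snd
  gain_symm e := by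
    rw [Φ.gain_symm]
    simp [mul_comm, mul_left_comm]

/-- Switching equivalence of gain graphs on the same underlying graph. -/
def SwitchingEquivalent (Φ₁ Φ₂ : TGainGraph Γ) : Prop :=
  ∃ ζ : V → Circle, Φ₂ = Φ₁.switch ζ

/-- The gain graph `(Γ, -1)`, all of whose gains are `-1`. -/
noncomputable def allNegOne (Γ : SimpleGraph V) : TGainGraph Γ where
  gain _ := -1
  gain_symm _ := by simp

variable [DecidableRel Γ.Adj]

/-- The adjacency matrix: entry `φ(e_ij)` if `i` and `j` are adjacent, and `0` otherwise. -/
noncomputable def adjMatrix (Φ : TGainGraph Γ) : Matrix V V ℂ :=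
  Matrix.of fun i j => if h : Γ.Adj i j then (Φ.gain ⟨(i, j), h⟩ : ℂ) else 0

theorem adjMatrix_isHermitian (Φ : TGainGraph Γ) : Φ.adjMatrix.IsHermitian := by
  ext i j
  by_cases h : Γ.Adj i j
  · have h2 := Φ.gain_symm ⟨(i, j), h⟩
    have h3 : (⟨(i, j), h⟩ : Γ.Dart).symm = ⟨(j, i), h.symm⟩ := rfl
    rw [h3] at h2
    simp [adjMatrix, Matrix.conjTranspose_apply, h, h.symm, h2, ← Circle.coe_inv_eq_conj]
  · have h' : ¬ Γ.Adj j i := fun k => h k.symm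
    simp [adjMatrix, Matrix.conjTranspose_apply, h, h']

variable [Fintype V] [DecidableEq V]

/-- The Laplacian matrix `L(Φ) = D(Γ) - A(Φ)`. -/
noncomputable def laplacian (Φ : TGainGraph Γ) : Matrix V V ℂ :=
  Γ.degMatrix ℂ - Φ.adjMatrix

theorem laplacian_isHermitian (Φ : TGainGraph Γ) : Φ.laplacian.IsHermitian := by
  refine Matrix.IsHermitian.sub ?_ Φ.adjMatrix_isHermitian
  rw [SimpleGraph.degMatrix]
  exact Matrix.isHermitian_diagonal_of_self_adjoint _ (by ext i; simp)

end TGainGraph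

namespace SimpleGraph

variable {V : Type*} [Fintype V] (Γ : SimpleGraph V) [DecidableRel Γ.Adj]

/-- The signless Laplacian `Q(Γ) = D(Γ) + A(Γ)`, with complex entries. -/
noncomputable def signlessLaplacian [DecidableEq V] : Matrix V V ℂ :=
  Γ.degMatrix ℂ + Γ.adjMatrix ℂ

theorem signlessLaplacian_isHermitian [DecidableEq V] : Γ.signlessLaplacian.IsHermitian := by
  refine Matrix.IsHermitian.add ?_ ?_
  · rw [SimpleGraph.degMatrix]
    exact Matrix.isHermitian_diagonal_of_self_adjoint _ (by ext i; simp)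
  · ext i j
    by_cases h : Γ.Adj j i <;> simp [Matrix.conjTranspose_apply, SimpleGraph.adjMatrix_apply,
      Γ.adj_comm i j, h]

/-- The signless Laplacian is the Laplacian of `(Γ, -1)`. -/
theorem signlessLaplacian_eq [DecidableEq V] :
    Γ.signlessLaplacian = (TGainGraph.allNegOne Γ).laplacian := by
  ext i j
  by_cases h : Γ.Adj i j <;> simp [signlessLaplacian, TGainGraph.laplacian, TGainGraph.adjMatrix,
    TGainGraph.allNegOne, SimpleGraph.adjMatrix_apply, h]

/-- The average 2-degree `m_i = (∑ d_k) / d_i`, the sum being over the neighbours `k` of `i`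
(it is `0` at an isolated vertex). -/
noncomputable def averageTwoDegree (i : V) : ℝ :=
  (∑ k ∈ Γ.neighborFinset i, (Γ.degree k : ℝ)) / (Γ.degree i : ℝ)

/-- The maximum of `f i` over all vertices. -/
noncomputable def vertexMax {V : Type*} [Fintype V] [Nonempty V] (f : V → ℝ) : ℝ :=
  Finset.univ.sup' Finset.univ_nonempty f

/-- The maximum of `f i j` over all oriented edges `e_ij`; for an `f` that is symmetric in `i` and
`j` this is the maximum over all edges. -/
noncomputable def edgeMax [Nonempty Γ.Dart] (f : V → V → ℝ) : ℝ :=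
  Finset.univ.sup' Finset.univ_nonempty fun e : Γ.Dart => f e.fst e.snd

end SimpleGraph

/-- The largest eigenvalue `λ₁(A)` of a Hermitian matrix. -/
noncomputable def Matrix.IsHermitian.largestEigenvalue {V : Type*} [Fintype V] [DecidableEq V]
    [Nonempty V] {A : Matrix V V ℂ} (hA : A.IsHermitian) : ℝ :=
  Finset.univ.sup' Finset.univ_nonempty hA.eigenvalues

open Finset Matrix
open scoped ComplexOrder

/-! Everything passes through a nonnegative nonzero `u` with `lam • u ≤ Q(Γ) u` entrywise. By the
triangle inequality, the absolute values of an eigenvector of `L(Φ)` form such a `u`. The Rayleigh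
quotient of `Q(Γ)` then gives `lam ≤ λ₁(Q)`. If equality holds, `u` is an eigenvector of `Q(Γ)`,
positive by connectedness, and every triangle inequality is sharp; this fixes the phases of the
original eigenvector, and they are the switching function.

The bounds are proved for `λ₁(Q)` by Collatz–Wielandt arguments: evaluate the inequality where `u /
w` is largest, for a suitable positive weight `w`. Edge bounds use the edge sums `u i + u j`, on
which `Q(Γ) - 2` acts as the adjacency matrix of the line graph. The equality statements follow from
`lamL ≤ lamQ ≤ B`. -/

theorem exists_max_ratio {ι : Type*} [Fintype ι] {u w : ι → ℝ} (hw : ∀ i, 0 < w i)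
    (h : ∃ i, 0 < u i) : ∃ i t, 0 < t ∧ u i = t * w i ∧ ∀ k, u k ≤ t * w k := by
  obtain ⟨i₀, hi₀⟩ := h
  obtain ⟨i, -, hi⟩ := exists_max_image univ (fun i => u i / w i) ⟨i₀, mem_univ _⟩
  refine ⟨i, u i / w i, (div_pos hi₀ (hw i₀)).trans_le (hi i₀ (mem_univ _)),
    (div_mul_cancel₀ _ (hw i).ne').symm, fun k => ?_⟩
  exact (div_le_iff₀ (hw k)).1 (hi k (mem_univ _))

/-! ### Subsolutions and estimates at a maximal ratio -/

namespace SimpleGraph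

variable {V : Type*} [Fintype V] {Γ : SimpleGraph V} [DecidableRel Γ.Adj]

/-- A nonzero nonnegative vector `u` with `lam • u ≤ Q(Γ) u` entrywise. -/
structure IsSignlessSubsolution (Γ : SimpleGraph V) [DecidableRel Γ.Adj] (lam : ℝ) (u : V → ℝ) :
    Prop where
  nonneg : ∀ i, 0 ≤ u i
  exists_pos : ∃ i, 0 < u i
  le : ∀ i, lam * u i ≤ Γ.degree i * u i + ∑ k ∈ Γ.neighborFinset i, u k

theorem degree_mul_averageTwoDegree (i : V) :
    (Γ.degree i : ℝ) * Γ.averageTwoDegree i = ∑ k ∈ Γ.neighborFinset i, (Γ.degree k : ℝ) := by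
  rw [averageTwoDegree]
  by_cases h : Γ.degree i = 0
  · have : Γ.neighborFinset i = ∅ := by simpa [← card_neighborFinset_eq_degree] using h
    simp [this]
  · field_simp

theorem averageTwoDegree_nonneg (i : V) : 0 ≤ Γ.averageTwoDegree i := by
  unfold averageTwoDegree; positivity

theorem sum_neighborFinset_const_add_degree (i : V) (c : ℝ) :
    ∑ k ∈ Γ.neighborFinset i, (c + Γ.degree k) =
      Γ.degree i * c + Γ.degree i * Γ.averageTwoDegree i := by
  rw [sum_add_distrib, degree_mul_averageTwoDegree]; simp

namespace IsSignlessSubsolution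

variable {lam : ℝ} {u : V → ℝ}

theorem degree_pos (h : Γ.IsSignlessSubsolution lam u) (hlam : 0 < lam) (hΓ : Γ.Connected)
    (i : V) : 0 < Γ.degree i := by
  obtain ⟨j, hj⟩ := h.exists_pos
  have hd : Γ.degree j ≠ 0 := fun h0 => by
    have he : Γ.neighborFinset j = ∅ := by simpa [← card_neighborFinset_eq_degree] using h0
    have := h.le j
    simp only [h0, he, Nat.cast_zero, zero_mul, sum_empty, add_zero] at this
    exact this.not_gt (mul_pos hlam hj)
  obtain ⟨k, hk⟩ := (Γ.degree_pos_iff_exists_adj j).1 (Nat.pos_of_ne_zero hd)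
  have : Nontrivial V := ⟨j, k, hk.ne⟩
  exact hΓ.preconnected.degree_pos_of_nontrivial i

theorem exists_weight_le (h : Γ.IsSignlessSubsolution lam u) {w : V → ℝ} (hw : ∀ i, 0 < w i) :
    ∃ i, lam * w i ≤ Γ.degree i * w i + ∑ k ∈ Γ.neighborFinset i, w k := by
  obtain ⟨i, t, ht, hi, hk⟩ := exists_max_ratio hw h.exists_pos
  refine ⟨i, le_of_mul_le_mul_left ?_ ht⟩
  calc t * (lam * w i) = lam * u i := by rw [hi]; ring
    _ ≤ _ := h.le i
    _ ≤ Γ.degree i * u i + ∑ k ∈ Γ.neighborFinset i, t * w k := by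
      gcongr with k _; exact hk k
    _ = _ := by rw [hi, ← mul_sum]; ring

/-- The inequality is applied twice at a maximum of `u`: first at every vertex with the constant
bound, then at the maximum with the improved bound on its neighbours. Both estimates hold at the
same vertex, so they can be combined. -/
theorem exists_le_sq_le (h : Γ.IsSignlessSubsolution lam u) (hlam : 0 < lam) :
    ∃ i, lam ≤ 2 * Γ.degree i ∧
      lam ^ 2 ≤ lam * Γ.degree i + 2 * (Γ.degree i * Γ.averageTwoDegree i) := by
  obtain ⟨i, t, ht, hi, hk⟩ := exists_max_ratio (w := fun _ => 1) (fun _ => one_pos) h.exists_pos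
  simp only [mul_one] at hi hk
  have key : ∀ j, lam * u j ≤ t * (2 * Γ.degree j) := fun j => calc
    _ ≤ _ := h.le j
    _ ≤ Γ.degree j * t + ∑ k ∈ Γ.neighborFinset j, t := by
      gcongr with k _
      · exact hk j
      · exact hk k
    _ = _ := by simp; ring
  refine ⟨i, le_of_mul_le_mul_left ?_ ht, le_of_mul_le_mul_left ?_ ht⟩
  · calc t * lam = lam * u i := by rw [hi, mul_comm]
      _ ≤ _ := key i
  · calc t * lam ^ 2 = lam * (lam * u i) := by rw [hi]; ring
      _ ≤ lam * (Γ.degree i * u i + ∑ k ∈ Γ.neighborFinset i, u k) := by gcongr; exact h.le i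
      _ = lam * Γ.degree i * t + ∑ k ∈ Γ.neighborFinset i, lam * u k := by
        rw [hi, ← mul_sum]; ring
      _ ≤ lam * Γ.degree i * t + ∑ k ∈ Γ.neighborFinset i, t * (2 * Γ.degree k) :=
        add_le_add_right (sum_le_sum fun k _ => key k) _
      _ = _ := by rw [degree_mul_averageTwoDegree, ← mul_sum, ← mul_sum]; ring

theorem edge_le (h : Γ.IsSignlessSubsolution lam u) (i j : V) :
    lam * (u i + u j) ≤
      ∑ k ∈ Γ.neighborFinset i, (u i + u k) + ∑ k ∈ Γ.neighborFinset j, (u j + u k) := by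
  have hi := h.le i
  have hj := h.le j
  simp only [sum_add_distrib, sum_const, card_neighborFinset_eq_degree, nsmul_eq_mul]
  linarith

theorem exists_dart_pos (h : Γ.IsSignlessSubsolution lam u) (hd : ∀ i, 0 < Γ.degree i) :
    ∃ e : Γ.Dart, 0 < u e.fst + u e.snd := by
  obtain ⟨i, hi⟩ := h.exists_pos
  obtain ⟨k, hk⟩ := (Γ.degree_pos_iff_exists_adj i).1 (hd i)
  exact ⟨⟨(i, k), hk⟩, add_pos_of_pos_of_nonneg hi (h.nonneg k)⟩

theorem exists_edge_weight_le (h : Γ.IsSignlessSubsolution lam u) (hd : ∀ i, 0 < Γ.degree i)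
    {w : V → V → ℝ} (hw : ∀ i j, 0 < w i j) :
    ∃ e : Γ.Dart, lam * w e.fst e.snd ≤
      ∑ k ∈ Γ.neighborFinset e.fst, w e.fst k + ∑ k ∈ Γ.neighborFinset e.snd, w e.snd k := by
  classical
  obtain ⟨e, t, ht, he, hk⟩ := exists_max_ratio (u := fun e : Γ.Dart => u e.fst + u e.snd)
    (w := fun e : Γ.Dart => w e.fst e.snd) (fun e => hw _ _) (h.exists_dart_pos hd)
  have key : ∀ i, ∑ k ∈ Γ.neighborFinset i, (u i + u k) ≤
      ∑ k ∈ Γ.neighborFinset i, t * w i k := fun i => sum_le_sum fun k hik =>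
    hk ⟨(i, k), (Γ.mem_neighborFinset i k).1 hik⟩
  refine ⟨e, le_of_mul_le_mul_left ?_ ht⟩
  calc t * (lam * w e.fst e.snd) = lam * (u e.fst + u e.snd) := by rw [he]; ring
    _ ≤ _ := h.edge_le _ _
    _ ≤ _ := add_le_add (key _) (key _)
    _ = _ := by rw [← mul_sum, ← mul_sum]; ring

/-- The edge `ij` itself occurs once in each sum of `edge_le`; removing both occurrences leaves the
line-graph neighbours. -/
theorem edge_sub_two_le [DecidableEq V] (h : Γ.IsSignlessSubsolution lam u) {i j : V}
    (hij : Γ.Adj i j) :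
    (lam - 2) * (u i + u j) ≤
      ∑ k ∈ (Γ.neighborFinset i).erase j, (u i + u k) +
        ∑ k ∈ (Γ.neighborFinset j).erase i, (u j + u k) := by
  have h1 := sum_erase_add (Γ.neighborFinset i) (fun k => u i + u k)
    ((Γ.mem_neighborFinset i j).2 hij)
  have h2 := sum_erase_add (Γ.neighborFinset j) (fun k => u j + u k)
    ((Γ.mem_neighborFinset j i).2 hij.symm)
  have := h.edge_le i j
  linarith

/-- The line-graph analogue of `exists_le_sq_le`: two applications of the inequality at an edge with
maximal sum. The hypothesis `2 ≤ lam` allows multiplication by `lam - 2`. -/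
theorem exists_edge_le_sq_le (h : Γ.IsSignlessSubsolution lam u) (hd : ∀ i, 0 < Γ.degree i)
    (hlam : 2 ≤ lam) :
    ∃ e : Γ.Dart, lam ≤ Γ.degree e.fst + Γ.degree e.snd ∧ (lam - 2) ^ 2 ≤
      Γ.degree e.fst * (Γ.degree e.fst + Γ.averageTwoDegree e.fst - 4) +
        Γ.degree e.snd * (Γ.degree e.snd + Γ.averageTwoDegree e.snd - 4) + 4 := by
  classical
  obtain ⟨⟨⟨i, j⟩, hij⟩, t, ht, he, hk⟩ := exists_max_ratio
    (u := fun e : Γ.Dart => u e.fst + u e.snd)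
    (w := fun e : Γ.Dart => 1) (fun e => one_pos) (h.exists_dart_pos hd)
  simp only [mul_one] at he hk
  have sum_one : ∀ {i j}, Γ.Adj i j → ∑ k ∈ (Γ.neighborFinset i).erase j, (u i + u k) ≤
      t * (Γ.degree i - 1) := fun {i j} hij => by
    calc _ ≤ ∑ k ∈ (Γ.neighborFinset i).erase j, t := sum_le_sum fun k hik =>
          hk ⟨(i, k), (Γ.mem_neighborFinset i k).1 (mem_of_mem_erase hik)⟩
      _ = _ := by
        rw [eq_sub_of_add_eq (sum_erase_add (Γ.neighborFinset i) (fun _ => t)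
          ((Γ.mem_neighborFinset i j).2 hij))]
        simp; ring
  -- The factor on the right is the degree of `ij` in the line graph.
  have key : ∀ {i j}, Γ.Adj i j → (lam - 2) * (u i + u j) ≤
      t * (Γ.degree i - 2 + Γ.degree j) := fun {i j} hij => by
    have := h.edge_sub_two_le hij
    have h1 := sum_one hij
    have h2 := sum_one hij.symm
    linarith
  have sum_two : ∀ {i j}, Γ.Adj i j →
      (lam - 2) * ∑ k ∈ (Γ.neighborFinset i).erase j, (u i + u k) ≤
      t * (Γ.degree i * (Γ.degree i - 2) + Γ.degree i * Γ.averageTwoDegree i -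
        (Γ.degree i - 2 + Γ.degree j)) := fun {i j} hij => by
    rw [mul_sum]
    calc _ ≤ ∑ k ∈ (Γ.neighborFinset i).erase j, t * (Γ.degree i - 2 + Γ.degree k) :=
          sum_le_sum fun k hik => key ((Γ.mem_neighborFinset i k).1 (mem_of_mem_erase hik))
      _ = _ := by
        rw [← mul_sum, ← sum_neighborFinset_const_add_degree, eq_sub_of_add_eq
          (sum_erase_add (Γ.neighborFinset i) (fun k => (Γ.degree i - 2 + Γ.degree k : ℝ))
            ((Γ.mem_neighborFinset i j).2 hij))]
  refine ⟨⟨(i, j), hij⟩, ?_, le_of_mul_le_mul_left ?_ ht⟩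
  · have := key hij
    rw [he, mul_comm] at this
    have := le_of_mul_le_mul_left this ht
    simp only
    linarith
  · have h1 := sum_two hij
    have h2 := sum_two hij.symm
    have h3 := mul_le_mul_of_nonneg_left (h.edge_sub_two_le hij) (sub_nonneg.2 hlam)
    rw [he] at h3
    simp only
    linarith

/-- Take `i` maximizing `u / d` overall and `j` maximizing it among the neighbours of `i`. The
inequalities at `i` and `j` bound each ratio by the other; their product eliminates both ratios once
`lam` exceeds both degrees. -/
theorem exists_edge_mul_le (h : Γ.IsSignlessSubsolution lam u) (hd : ∀ i, 0 < Γ.degree i) :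
    ∃ e : Γ.Dart, lam ≤ Γ.degree e.fst ∨ lam ≤ Γ.degree e.snd ∨
      (lam - Γ.degree e.fst) * (lam - Γ.degree e.snd) ≤
        Γ.averageTwoDegree e.fst * Γ.averageTwoDegree e.snd := by
  have hd' : ∀ i, 0 < (Γ.degree i : ℝ) := fun i => Nat.cast_pos.2 (hd i)
  obtain ⟨i, t, ht, hi, hk⟩ := exists_max_ratio hd' h.exists_pos
  have hne : (Γ.neighborFinset i).Nonempty := by
    rw [← card_pos, card_neighborFinset_eq_degree]; exact hd i
  obtain ⟨j, hj, hjmax⟩ := exists_max_image _ (fun k => u k / Γ.degree k) hne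
  refine ⟨⟨(i, j), (Γ.mem_neighborFinset i j).1 hj⟩, ?_⟩
  simp only
  set s := u j / Γ.degree j with hs
  have huj : u j = s * Γ.degree j := (div_mul_cancel₀ _ (hd' j).ne').symm
  have gen : ∀ (l : V) (a b : ℝ), u l = a * Γ.degree l →
      (∀ k ∈ Γ.neighborFinset l, u k ≤ b * Γ.degree k) →
      (lam - Γ.degree l) * a ≤ Γ.averageTwoDegree l * b := fun l a b ha hb => by
    refine le_of_mul_le_mul_left ?_ (hd' l)
    have h1 := h.le l
    have h2 := sum_le_sum hb
    rw [← mul_sum, ← degree_mul_averageTwoDegree] at h2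
    rw [ha] at h1
    linarith
  have h1 := gen i t s hi fun k hk => (div_le_iff₀ (hd' k)).1 (hjmax k hk)
  have h2 := gen j s t huj fun k _ => hk k
  by_contra! hcon
  obtain ⟨hci, hcj, hc⟩ := hcon
  have hs0 : 0 < s := by
    by_contra! hs0
    have := mul_pos (sub_pos.2 hci) ht
    have := mul_nonneg (averageTwoDegree_nonneg (Γ := Γ) i) (neg_nonneg.2 hs0)
    linarith
  have h3 := mul_le_mul h1 h2 (mul_pos (sub_pos.2 hcj) hs0).le
    (mul_nonneg (averageTwoDegree_nonneg i) hs0.le)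
  have h4 := mul_lt_mul_of_pos_right hc (mul_pos ht hs0)
  linarith

end IsSignlessSubsolution

end SimpleGraph

/-! ### The ten bounds for a subsolution -/

namespace SimpleGraph

theorem le_vertexMax_of_le {V : Type*} [Fintype V] [Nonempty V] {f : V → ℝ} {c : ℝ} (i : V)
    (h : c ≤ f i) : c ≤ vertexMax f :=
  h.trans (le_sup' f (mem_univ i))

theorem le_edgeMax_of_le {V : Type*} [Fintype V] {Γ : SimpleGraph V} [DecidableRel Γ.Adj]
    [Nonempty Γ.Dart] {f : V → V → ℝ} {c : ℝ} (e : Γ.Dart) (h : c ≤ f e.fst e.snd) :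
    c ≤ Γ.edgeMax f :=
  h.trans (le_sup' (fun e : Γ.Dart => f e.fst e.snd) (mem_univ e))

variable {V : Type*} [Fintype V] {Γ : SimpleGraph V} [DecidableRel Γ.Adj]

namespace IsSignlessSubsolution

variable {lam : ℝ} {u : V → ℝ}

theorem le_two_mul_maxDegree (h : Γ.IsSignlessSubsolution lam u) : lam ≤ 2 * Γ.maxDegree := by
  obtain ⟨i, hi⟩ := h.exists_weight_le (w := fun _ => 1) (fun _ => one_pos)
  have hm : (Γ.degree i : ℝ) ≤ Γ.maxDegree := Nat.cast_le.2 (Γ.degree_le_maxDegree i)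
  simp only [mul_one, sum_const, card_neighborFinset_eq_degree, nsmul_eq_mul] at hi
  linarith

theorem le_vertexMax_add [Nonempty V] (h : Γ.IsSignlessSubsolution lam u) (hΓ : Γ.Connected) :
    lam ≤ vertexMax fun i => Γ.degree i + Γ.averageTwoDegree i := by
  -- Degrees are known to be positive only for `lam > 0`; this split covers the one-vertex graph.
  rcases le_or_gt lam 0 with hlam | hlam
  · refine le_vertexMax_of_le (Classical.arbitrary V) (hlam.trans ?_)
    exact add_nonneg (Nat.cast_nonneg _) (averageTwoDegree_nonneg _)
  have hd := h.degree_pos hlam hΓ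
  obtain ⟨i, hi⟩ := h.exists_weight_le (w := fun i => Γ.degree i) (fun i => Nat.cast_pos.2 (hd i))
  refine le_vertexMax_of_le i (le_of_mul_le_mul_right ?_ (Nat.cast_pos.2 (hd i)))
  rw [← degree_mul_averageTwoDegree] at hi
  linarith

theorem le_vertexMax_add_sqrt [Nonempty V] (h : Γ.IsSignlessSubsolution lam u) (hΓ : Γ.Connected) :
    lam ≤ vertexMax fun i => Γ.degree i + √(Γ.degree i * Γ.averageTwoDegree i) := by
  rcases le_or_gt lam 0 with hlam | hlam
  · exact le_vertexMax_of_le (Classical.arbitrary V) (hlam.trans (by positivity))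
  have hd := fun i => Real.sqrt_pos.2 (Nat.cast_pos.2 (h.degree_pos hlam hΓ i))
  obtain ⟨i, hi⟩ := h.exists_weight_le hd
  refine le_vertexMax_of_le i (le_of_mul_le_mul_right ?_ (hd i))
  -- Cauchy–Schwarz, for the weight `√d`.
  have hcs : ∑ k ∈ Γ.neighborFinset i, √(Γ.degree k : ℝ) ≤
      √(Γ.degree i : ℝ) * √(Γ.degree i * Γ.averageTwoDegree i) := by
    rw [degree_mul_averageTwoDegree, ← card_neighborFinset_eq_degree]
    simpa using Real.sum_sqrt_mul_sqrt_le (Γ.neighborFinset i) (f := fun _ => (1 : ℝ))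
      (g := fun k => (Γ.degree k : ℝ)) (fun _ => zero_le_one) (fun _ => Nat.cast_nonneg _)
  linarith

theorem le_vertexMax_sqrt [Nonempty V] (h : Γ.IsSignlessSubsolution lam u) :
    lam ≤ vertexMax fun i => √(2 * Γ.degree i * (Γ.degree i + Γ.averageTwoDegree i)) := by
  rcases le_or_gt lam 0 with hlam | hlam
  · exact le_vertexMax_of_le (Classical.arbitrary V) (hlam.trans (by positivity))
  obtain ⟨i, h1, h2⟩ := h.exists_le_sq_le hlam
  refine le_vertexMax_of_le i (Real.le_sqrt_of_sq_le ?_)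
  have := mul_le_mul_of_nonneg_right h1 (Nat.cast_nonneg (α := ℝ) (Γ.degree i))
  linarith

theorem le_vertexMax_half [Nonempty V] (h : Γ.IsSignlessSubsolution lam u) :
    lam ≤ vertexMax fun i => (Γ.degree i +
      √((Γ.degree i : ℝ) ^ 2 + 8 * (Γ.degree i * Γ.averageTwoDegree i))) / 2 := by
  rcases le_or_gt lam 0 with hlam | hlam
  · exact le_vertexMax_of_le (Classical.arbitrary V) (hlam.trans (by positivity))
  obtain ⟨i, h1, h2⟩ := h.exists_le_sq_le hlam
  refine le_vertexMax_of_le i ?_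
  have : 2 * lam - Γ.degree i ≤
      √((Γ.degree i : ℝ) ^ 2 + 8 * (Γ.degree i * Γ.averageTwoDegree i)) :=
    Real.le_sqrt_of_sq_le (by linarith)
  linarith

variable [Nonempty Γ.Dart]

theorem le_edgeMax_add (h : Γ.IsSignlessSubsolution lam u) (hd : ∀ i, 0 < Γ.degree i) :
    lam ≤ Γ.edgeMax fun i j => Γ.degree i + Γ.degree j := by
  obtain ⟨e, he⟩ := h.exists_edge_weight_le hd (w := fun _ _ => 1) fun _ _ => one_pos
  refine le_edgeMax_of_le e ?_
  simpa using he

theorem le_edgeMax_div (h : Γ.IsSignlessSubsolution lam u) (hd : ∀ i, 0 < Γ.degree i) :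
    lam ≤ Γ.edgeMax fun i j => (Γ.degree i * (Γ.degree i + Γ.averageTwoDegree i) +
      Γ.degree j * (Γ.degree j + Γ.averageTwoDegree j)) / (Γ.degree i + Γ.degree j) := by
  have hd' : ∀ i j, 0 < (Γ.degree i + Γ.degree j : ℝ) := fun i j =>
    add_pos (Nat.cast_pos.2 (hd i)) (Nat.cast_pos.2 (hd j))
  obtain ⟨e, he⟩ := h.exists_edge_weight_le hd hd'
  refine le_edgeMax_of_le e ((le_div_iff₀ (hd' _ _)).2 ?_)
  rw [sum_neighborFinset_const_add_degree, sum_neighborFinset_const_add_degree] at he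
  linarith

theorem le_edgeMax_two_add_sqrt (h : Γ.IsSignlessSubsolution lam u)
    (hd : ∀ i, 0 < Γ.degree i) :
    lam ≤ Γ.edgeMax fun i j =>
      2 + √(Γ.degree i * (Γ.degree i + Γ.averageTwoDegree i - 4) +
        Γ.degree j * (Γ.degree j + Γ.averageTwoDegree j - 4) + 4) := by
  rcases le_or_gt lam 2 with hlam | hlam
  · exact le_edgeMax_of_le (Classical.arbitrary Γ.Dart)
      (hlam.trans (le_add_of_nonneg_right (Real.sqrt_nonneg _)))
  obtain ⟨e, -, he⟩ := h.exists_edge_le_sq_le hd hlam.le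
  refine le_edgeMax_of_le e ?_
  linarith [Real.le_sqrt_of_sq_le he]

theorem le_edgeMax_sqrt (h : Γ.IsSignlessSubsolution lam u) (hd : ∀ i, 0 < Γ.degree i) :
    lam ≤ Γ.edgeMax fun i j => √(Γ.degree i * (Γ.degree i + Γ.averageTwoDegree i) +
      Γ.degree j * (Γ.degree j + Γ.averageTwoDegree j)) := by
  rcases le_or_gt lam 2 with hlam | hlam
  · refine le_edgeMax_of_le (Classical.arbitrary Γ.Dart) (hlam.trans ?_)
    refine Real.le_sqrt_of_sq_le ?_
    -- Two such terms make the radicand at least `4 = 2 ^ 2`.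
    have h1 : ∀ i, (2 : ℝ) ≤ Γ.degree i * (Γ.degree i + Γ.averageTwoDegree i) := fun i => by
      have hi : ∀ i, (1 : ℝ) ≤ Γ.degree i := fun i => Nat.one_le_cast.2 (hd i)
      calc (2 : ℝ) ≤ Γ.degree i * (1 + 1) := by linarith [hi i]
        _ = ∑ k ∈ Γ.neighborFinset i, (1 + 1 : ℝ) := by simp [mul_add]
        _ ≤ ∑ k ∈ Γ.neighborFinset i, ((Γ.degree i : ℝ) + Γ.degree k) := by
          gcongr with k _
          · exact hi i
          · exact hi k
        _ = _ := by rw [sum_neighborFinset_const_add_degree]; ring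
    linarith [h1 (Classical.arbitrary Γ.Dart).fst, h1 (Classical.arbitrary Γ.Dart).snd]
  obtain ⟨e, he1, he2⟩ := h.exists_edge_le_sq_le hd hlam.le
  -- Expanding `(lam - 2) ^ 2`, the term `4 * lam` is absorbed by four times the degree sum.
  exact le_edgeMax_of_le e (Real.le_sqrt_of_sq_le (by linarith))

theorem le_edgeMax_half (h : Γ.IsSignlessSubsolution lam u) (hd : ∀ i, 0 < Γ.degree i) :
    lam ≤ Γ.edgeMax fun i j => (Γ.degree i + Γ.degree j +
      √((Γ.degree i - Γ.degree j : ℝ) ^ 2 +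
        4 * Γ.averageTwoDegree i * Γ.averageTwoDegree j)) / 2 := by
  obtain ⟨e, he⟩ := h.exists_edge_mul_le hd
  refine le_edgeMax_of_le e ?_
  have hm := mul_nonneg (averageTwoDegree_nonneg (Γ := Γ) e.fst)
    (averageTwoDegree_nonneg (Γ := Γ) e.snd)
  have habs : |(Γ.degree e.fst - Γ.degree e.snd : ℝ)| ≤
      √((Γ.degree e.fst - Γ.degree e.snd : ℝ) ^ 2 +
        4 * Γ.averageTwoDegree e.fst * Γ.averageTwoDegree e.snd) :=
    Real.abs_le_sqrt (by linarith)
  rcases he with he | he | he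
  · linarith [le_abs_self (Γ.degree e.fst - Γ.degree e.snd : ℝ)]
  · linarith [neg_abs_le (Γ.degree e.fst - Γ.degree e.snd : ℝ)]
  · have : 2 * lam - (Γ.degree e.fst + Γ.degree e.snd) ≤
        √((Γ.degree e.fst - Γ.degree e.snd : ℝ) ^ 2 +
          4 * Γ.averageTwoDegree e.fst * Γ.averageTwoDegree e.snd) :=
      Real.le_sqrt_of_sq_le (by linarith)
    linarith

end IsSignlessSubsolution

end SimpleGraph

/-! ### Variational facts on the largest eigenvalue -/

section LargestEigenvalue

variable {V : Type*} [Fintype V] [DecidableEq V] [Nonempty V] {A : Matrix V V ℂ}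

theorem Matrix.IsHermitian.exists_mulVec_eq_largestEigenvalue (hA : A.IsHermitian) :
    ∃ x : V → ℂ, x ≠ 0 ∧ A *ᵥ x = (hA.largestEigenvalue : ℂ) • x := by
  obtain ⟨i, -, hi⟩ := exists_mem_eq_sup' univ_nonempty hA.eigenvalues
  refine ⟨hA.eigenvectorBasis i, fun h => hA.eigenvectorBasis.toBasis.ne_zero i ?_, ?_⟩
  · ext j
    simpa using congrFun h j
  · rw [hA.mulVec_eigenvectorBasis, largestEigenvalue, hi]
    ext j
    simp

theorem Matrix.IsHermitian.le_largestEigenvalue (hA : A.IsHermitian) {x : V → ℂ} (hx : x ≠ 0)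
    {μ : ℝ} (h : A *ᵥ x = (μ : ℂ) • x) : μ ≤ hA.largestEigenvalue := by
  have hmem : (μ : ℂ) ∈ spectrum ℂ A := by
    rw [← Matrix.spectrum_toLin', ← Module.End.hasEigenvalue_iff_mem_spectrum]
    exact Module.End.hasEigenvalue_of_hasEigenvector
      (Module.End.hasEigenvector_iff.2 ⟨Module.End.mem_eigenspace_iff.2 (by simpa using h), hx⟩)
  rw [hA.spectrum_eq_image_range] at hmem
  obtain ⟨-, ⟨i, rfl⟩, hi⟩ := hmem
  rw [← Complex.ofReal_injective hi]
  exact le_sup' hA.eigenvalues (mem_univ i)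

theorem Matrix.IsHermitian.posSemidef_largestEigenvalue_smul_one_sub (hA : A.IsHermitian) :
    ((hA.largestEigenvalue : ℂ) • (1 : Matrix V V ℂ) - A).PosSemidef := by
  have hM : ((hA.largestEigenvalue : ℂ) • (1 : Matrix V V ℂ) - A).IsHermitian :=
    IsHermitian.sub (by simp [IsHermitian, conjTranspose_smul]) hA
  refine hM.posSemidef_iff_eigenvalues_nonneg.2 fun i => ?_
  have hx : ⇑(hM.eigenvectorBasis i) ≠ 0 := fun h =>
    hM.eigenvectorBasis.toBasis.ne_zero i (by ext j; simpa using congrFun h j)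
  have h := hM.mulVec_eigenvectorBasis i
  rw [sub_mulVec, smul_mulVec, one_mulVec] at h
  have := hA.le_largestEigenvalue (μ := hA.largestEigenvalue - hM.eigenvalues i) hx (by
    ext j
    have hj := congrFun h j
    simp only [Pi.smul_apply, Pi.sub_apply, smul_eq_mul, Complex.real_smul,
      Complex.ofReal_sub] at hj ⊢
    linear_combination -hj)
  simpa using this

end LargestEigenvalue

/-! ### Positivity, absolute values and comparison with `Q(Γ)` -/

namespace SimpleGraph

variable {V : Type*} [Fintype V] {Γ : SimpleGraph V} [DecidableRel Γ.Adj]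

/-- At a zero of `u` the equation makes a sum of nonnegative neighbour values vanish, so zeros
spread along walks. -/
theorem Connected.pos_of_signless_eigenvector (hΓ : Γ.Connected) {lam : ℝ} {u : V → ℝ}
    (h : Γ.IsSignlessSubsolution lam u)
    (heq : ∀ i, lam * u i = Γ.degree i * u i + ∑ k ∈ Γ.neighborFinset i, u k) (i : V) :
    0 < u i := by
  have step : ∀ {i j}, Γ.Adj i j → u i = 0 → u j = 0 := fun {i j} hij hi => by
    have h1 := heq i
    rw [hi, mul_zero, mul_zero, zero_add, eq_comm,
      sum_eq_zero_iff_of_nonneg fun k _ => h.nonneg k] at h1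
    exact h1 j ((Γ.mem_neighborFinset i j).2 hij)
  have walk : ∀ {i j}, Γ.Walk i j → u i = 0 → u j = 0 := fun p => by
    induction p with
    | nil => exact id
    | cons hadj _ ih => exact fun hi => ih (step hadj hi)
  obtain ⟨j, hj⟩ := h.exists_pos
  refine (h.nonneg i).lt_of_ne fun hi => hj.ne' ?_
  obtain ⟨p⟩ := hΓ.preconnected i j
  exact walk p hi.symm

end SimpleGraph

namespace TGainGraph

variable {V : Type*} {Γ : SimpleGraph V} [DecidableRel Γ.Adj]

theorem norm_adjMatrix (Φ : TGainGraph Γ) (i k : V) :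
    ‖Φ.adjMatrix i k‖ = if Γ.Adj i k then 1 else 0 := by
  by_cases h : Γ.Adj i k
  · simpa [adjMatrix, h] using Circle.norm_coe _
  · simp [adjMatrix, h]

variable [Fintype V]

theorem sum_norm_adjMatrix_mul (Φ : TGainGraph Γ) (x : V → ℂ) (i : V) :
    ∑ k, ‖Φ.adjMatrix i k * x k‖ = ∑ k ∈ Γ.neighborFinset i, ‖x k‖ := by
  rw [SimpleGraph.neighborFinset_eq_filter, sum_filter]
  simp [norm_adjMatrix]

variable [DecidableEq V]

theorem laplacian_mulVec_apply (Φ : TGainGraph Γ) (x : V → ℂ) (i : V) :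
    (Φ.laplacian *ᵥ x) i = Γ.degree i * x i - ∑ k, Φ.adjMatrix i k * x k := by
  rw [laplacian, sub_mulVec, Pi.sub_apply, SimpleGraph.degMatrix_mulVec_apply]
  rfl

theorem isSignlessSubsolution_norm (Φ : TGainGraph Γ) {x : V → ℂ} {lam : ℝ} (hx : x ≠ 0)
    (h : Φ.laplacian *ᵥ x = (lam : ℂ) • x) :
    Γ.IsSignlessSubsolution lam fun i => ‖x i‖ where
  nonneg _ := norm_nonneg _
  exists_pos := by
    obtain ⟨i, hi⟩ := Function.ne_iff.1 hx
    exact ⟨i, norm_pos_iff.2 hi⟩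
  le i := by
    have hi := congrFun h i
    rw [laplacian_mulVec_apply, Pi.smul_apply, smul_eq_mul] at hi
    have : ((lam - Γ.degree i : ℝ) : ℂ) * x i = -∑ k, Φ.adjMatrix i k * x k := by
      push_cast; linear_combination -hi
    have hn := congrArg norm this
    rw [norm_mul, Complex.norm_real, Real.norm_eq_abs, norm_neg] at hn
    have h1 := norm_sum_le univ fun k => Φ.adjMatrix i k * x k
    rw [sum_norm_adjMatrix_mul] at h1
    have h2 := mul_le_mul_of_nonneg_right (le_abs_self (lam - Γ.degree i)) (norm_nonneg (x i))
    linarith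

end TGainGraph

namespace SimpleGraph

variable {V : Type*} [Fintype V] [DecidableEq V] {Γ : SimpleGraph V} [DecidableRel Γ.Adj]

theorem signlessLaplacian_mulVec_apply (x : V → ℂ) (i : V) :
    (Γ.signlessLaplacian *ᵥ x) i = Γ.degree i * x i + ∑ k ∈ Γ.neighborFinset i, x k := by
  rw [signlessLaplacian, add_mulVec, Pi.add_apply, degMatrix_mulVec_apply,
    adjMatrix_mulVec_apply]

namespace IsSignlessSubsolution

variable [Nonempty V] {lam : ℝ} {u : V → ℝ}

theorem le_largestEigenvalue_and_eq (h : Γ.IsSignlessSubsolution lam u) :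
    lam ≤ Γ.signlessLaplacian_isHermitian.largestEigenvalue ∧
      (lam = Γ.signlessLaplacian_isHermitian.largestEigenvalue →
        ∀ i, lam * u i = Γ.degree i * u i + ∑ k ∈ Γ.neighborFinset i, u k) := by
  set q := Γ.signlessLaplacian_isHermitian.largestEigenvalue
  have hM := Γ.signlessLaplacian_isHermitian.posSemidef_largestEigenvalue_smul_one_sub
  set M := (q : ℂ) • (1 : Matrix V V ℂ) - Γ.signlessLaplacian
  set x : V → ℂ := fun i => u i
  have hMx : ∀ i, (M *ᵥ x) i =
      ((q * u i - (Γ.degree i * u i + ∑ k ∈ Γ.neighborFinset i, u k) : ℝ) : ℂ) := fun i => by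
    rw [sub_mulVec, smul_mulVec, one_mulVec, Pi.sub_apply, signlessLaplacian_mulVec_apply]
    simp [x]
  have hform : star x ⬝ᵥ M *ᵥ x = ((∑ i, u i *
      (q * u i - (Γ.degree i * u i + ∑ k ∈ Γ.neighborFinset i, u k)) : ℝ) : ℂ) := by
    rw [dotProduct, Complex.ofReal_sum]
    refine sum_congr rfl fun i _ => ?_
    rw [hMx, Complex.ofReal_mul]
    simp [x]
  have hnn := hM.dotProduct_mulVec_nonneg x
  rw [hform, Complex.zero_le_real] at hnn
  have hle : ∑ i, u i * (q * u i - (Γ.degree i * u i + ∑ k ∈ Γ.neighborFinset i, u k)) ≤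
      (q - lam) * ∑ i, u i * u i := by
    rw [mul_sum]
    refine sum_le_sum fun i _ => ?_
    have := mul_le_mul_of_nonneg_left (h.le i) (h.nonneg i)
    linarith
  have hpos : 0 < ∑ i, u i * u i := by
    obtain ⟨i, hi⟩ := h.exists_pos
    exact sum_pos' (fun i _ => mul_self_nonneg _) ⟨i, mem_univ i, mul_pos hi hi⟩
  refine ⟨?_, fun heq i => ?_⟩
  · by_contra! hlt
    have := mul_neg_of_neg_of_pos (sub_neg.2 hlt) hpos
    linarith
  · rw [← heq, sub_self, zero_mul] at hle
    rw [← heq] at hnn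
    -- A positive semidefinite form vanishes only on the kernel of its matrix.
    have h0 : star x ⬝ᵥ M *ᵥ x = 0 := by
      rw [hform, ← heq, le_antisymm hle hnn, Complex.ofReal_zero]
    have := congrFun ((hM.dotProduct_mulVec_zero_iff x).1 h0) i
    rw [hMx, Pi.zero_apply, Complex.ofReal_eq_zero, ← heq] at this
    linarith

end IsSignlessSubsolution

end SimpleGraph

/-! ### Equality and switching -/

namespace TGainGraph

variable {V : Type*} {Γ : SimpleGraph V}

theorem switchingEquivalent_allNegOne_iff (Φ : TGainGraph Γ) :
    Φ.SwitchingEquivalent (allNegOne Γ) ↔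
      ∃ ζ : V → Circle, ∀ i j (h : Γ.Adj i j),
        (Φ.gain ⟨(i, j), h⟩ : ℂ) * ζ j = -(ζ i : ℂ) := by
  have key : ∀ (ζ : V → Circle) (e : Γ.Dart), -1 = (ζ e.fst)⁻¹ * Φ.gain e * ζ e.snd ↔
      (Φ.gain e : ℂ) * ζ e.snd = -(ζ e.fst : ℂ) := fun ζ e => by
    rw [mul_assoc, eq_inv_mul_iff_mul_eq, eq_comm, ← Circle.coe_inj]
    simp
  constructor
  · rintro ⟨ζ, hζ⟩
    exact ⟨ζ, fun i j h => (key ζ ⟨(i, j), h⟩).1 (congrFun (congrArg gain hζ) ⟨(i, j), h⟩)⟩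
  · rintro ⟨ζ, hζ⟩
    refine ⟨ζ, ?_⟩
    rw [allNegOne, switch, mk.injEq]
    exact funext fun e => (key ζ e).2 (hζ _ _ e.adj)

variable [Fintype V] [DecidableRel Γ.Adj] [DecidableEq V]

/-- Sharpness of the triangle inequality at `i` makes each term `c k` a nonnegative real, so
`φ(e_ij)` turns the phase of `x j` into minus the phase of `x i`. -/
theorem switchingEquivalent_allNegOne_of_eigenvector (Φ : TGainGraph Γ) {x : V → ℂ} {lam : ℝ}
    (h : Φ.laplacian *ᵥ x = (lam : ℂ) • x) (hx : ∀ i, 0 < ‖x i‖)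
    (heq : ∀ i, lam * ‖x i‖ = Γ.degree i * ‖x i‖ + ∑ k ∈ Γ.neighborFinset i, ‖x k‖) :
    Φ.SwitchingEquivalent (allNegOne Γ) := by
  refine Φ.switchingEquivalent_allNegOne_iff.2
    ⟨fun i => Circle.exp (Complex.arg (x i)), fun i j hij => ?_⟩
  set c : V → ℂ := fun k => -(star (x i) * (Φ.adjMatrix i k * x k))
  have hxi : star (x i) * x i = ((‖x i‖ * ‖x i‖ : ℝ) : ℂ) := by
    rw [Complex.star_def, mul_comm, Complex.mul_conj, Complex.normSq_eq_norm_sq, sq]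
  have hnorm : ∑ k, ‖c k‖ = (lam - Γ.degree i) * (‖x i‖ * ‖x i‖) := by
    simp only [c, norm_neg, norm_mul (star (x i)), norm_star]
    rw [← mul_sum, sum_norm_adjMatrix_mul]
    linear_combination -‖x i‖ * heq i
  have hsum : ∑ k, c k = (((lam - Γ.degree i) * (‖x i‖ * ‖x i‖) : ℝ) : ℂ) := by
    have hi := congrFun h i
    rw [laplacian_mulVec_apply, Pi.smul_apply, smul_eq_mul] at hi
    rw [sum_neg_distrib, ← mul_sum, Complex.ofReal_mul, ← hxi]
    push_cast
    linear_combination star (x i) * hi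
  have hre : ∑ k, (‖c k‖ - (c k).re) = 0 := by
    rw [sum_sub_distrib, hnorm, ← Complex.re_sum, hsum, Complex.ofReal_re, sub_self]
  have hcj := (sum_eq_zero_iff_of_nonneg fun k _ => sub_nonneg.2 (Complex.re_le_norm (c k))).1 hre
    j (mem_univ j)
  have hc0 : c j = ‖c j‖ := by
    have h0 : 0 ≤ c j := Complex.re_eq_norm.1 (sub_eq_zero.1 hcj).symm
    exact (Complex.eq_coe_norm_of_nonneg h0)
  have hcn : ‖c j‖ = ‖x i‖ * ‖x j‖ := by
    simp [c, norm_adjMatrix, hij]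
  rw [hcn] at hc0
  have hA : Φ.adjMatrix i j = Φ.gain ⟨(i, j), hij⟩ := by simp [adjMatrix, hij]
  have hxe : ∀ k, x k = ‖x k‖ * (Circle.exp (Complex.arg (x k)) : ℂ) := fun k => by
    rw [Circle.coe_exp, Complex.norm_mul_exp_arg_mul_I]
  have hne : ∀ k, (‖x k‖ : ℂ) ≠ 0 := fun k => Complex.ofReal_ne_zero.2 (hx k).ne'
  -- Multiplying by `x i` turns `star (x i)` into `‖x i‖ ^ 2`, which can be cancelled.
  have hmul := congrArg (x i * ·) hc0
  simp only [c] at hmul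
  rw [hA, Complex.ofReal_mul] at hmul
  refine mul_left_cancel₀ (mul_ne_zero (mul_ne_zero (hne i) (hne i)) (hne j)) ?_
  push_cast at hxi
  linear_combination -hmul + (‖x i‖ * ‖x i‖ * Φ.gain ⟨(i, j), hij⟩ : ℂ) * (-hxe j) -
    (Φ.gain ⟨(i, j), hij⟩ * x j : ℂ) * hxi - (‖x i‖ * ‖x j‖ : ℂ) * hxe i

variable [Nonempty V]

theorem largestEigenvalue_laplacian_le (Φ : TGainGraph Γ) :
    Φ.laplacian_isHermitian.largestEigenvalue ≤
      Γ.signlessLaplacian_isHermitian.largestEigenvalue := by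
  obtain ⟨x, hx, h⟩ := Φ.laplacian_isHermitian.exists_mulVec_eq_largestEigenvalue
  exact (Φ.isSignlessSubsolution_norm hx h).le_largestEigenvalue_and_eq.1

theorem largestEigenvalue_laplacian_eq_iff (Φ : TGainGraph Γ) (hΓ : Γ.Connected) :
    Φ.laplacian_isHermitian.largestEigenvalue =
      Γ.signlessLaplacian_isHermitian.largestEigenvalue ↔
        Φ.SwitchingEquivalent (allNegOne Γ) := by
  constructor
  · intro heq
    obtain ⟨x, hx, h⟩ := Φ.laplacian_isHermitian.exists_mulVec_eq_largestEigenvalue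
    have hu := Φ.isSignlessSubsolution_norm hx h
    have hu' := hu.le_largestEigenvalue_and_eq.2 heq
    exact Φ.switchingEquivalent_allNegOne_of_eigenvector h
      (hΓ.pos_of_signless_eigenvector hu hu') hu'
  · intro hs
    obtain ⟨ζ, hζ⟩ := Φ.switchingEquivalent_allNegOne_iff.1 hs
    refine Φ.largestEigenvalue_laplacian_le.antisymm ?_
    obtain ⟨y, hy, h⟩ := Γ.signlessLaplacian_isHermitian.exists_mulVec_eq_largestEigenvalue
    -- Multiplication by `ζ` carries eigenvectors of `Q(Γ)` to eigenvectors of `L(Φ)`.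
    refine Φ.laplacian_isHermitian.le_largestEigenvalue (x := fun i => ζ i * y i) ?_ ?_
    · obtain ⟨i, hi⟩ := Function.ne_iff.1 hy
      exact Function.ne_iff.2 ⟨i, mul_ne_zero (Circle.coe_ne_zero _) hi⟩
    · ext i
      have hi := congrFun h i
      rw [SimpleGraph.signlessLaplacian_mulVec_apply, Pi.smul_apply, smul_eq_mul] at hi
      have hA : ∑ k, Φ.adjMatrix i k * (ζ k * y k) = -(ζ i * ∑ k ∈ Γ.neighborFinset i, y k) := by
        rw [SimpleGraph.neighborFinset_eq_filter, sum_filter, mul_sum, ← sum_neg_distrib]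
        refine sum_congr rfl fun k _ => ?_
        by_cases hik : Γ.Adj i k
        · simp only [adjMatrix, of_apply, hik, dif_pos, if_pos, ← mul_assoc, hζ i k hik]
          ring
        · simp [adjMatrix, hik]
      rw [laplacian_mulVec_apply, hA, Pi.smul_apply, smul_eq_mul]
      linear_combination (ζ i : ℂ) * hi

end TGainGraph

theorem SimpleGraph.exists_isSignlessSubsolution {V : Type*} [Fintype V] [DecidableEq V]
    [Nonempty V] (Γ : SimpleGraph V) [DecidableRel Γ.Adj] :
    ∃ u, Γ.IsSignlessSubsolution Γ.signlessLaplacian_isHermitian.largestEigenvalue u := by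
  obtain ⟨x, hx, h⟩ := Γ.signlessLaplacian_isHermitian.exists_mulVec_eq_largestEigenvalue
  exact ⟨_, (TGainGraph.allNegOne Γ).isSignlessSubsolution_norm hx
    (by rw [← signlessLaplacian_eq]; exact h)⟩

theorem mainTheorem2 {V : Type*} [Fintype V] [DecidableEq V] [Nonempty V]
    (Γ : SimpleGraph V) [DecidableRel Γ.Adj] (hΓ : Γ.Connected) (Φ : TGainGraph Γ)
    (d m : V → ℝ) (hd : ∀ i, d i = (Γ.degree i : ℝ)) (hm : ∀ i, m i = Γ.averageTwoDegree i)
    (lamL lamQ : ℝ) (hlamL : lamL = Φ.laplacian_isHermitian.largestEigenvalue)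
    (hlamQ : lamQ = Γ.signlessLaplacian_isHermitian.largestEigenvalue) :
    -- comparison with the signless Laplacian and its case of equality
    (lamL ≤ lamQ ∧ (lamL = lamQ ↔ Φ.SwitchingEquivalent (TGainGraph.allNegOne Γ))) ∧
    -- the five bounds that are maxima over the vertices
    (∀ B ∈ ([2 * (Γ.maxDegree : ℝ),
        SimpleGraph.vertexMax fun i => d i + m i,
        SimpleGraph.vertexMax fun i => d i + √(d i * m i),
        SimpleGraph.vertexMax fun i => √(2 * d i * (d i + m i)),
        SimpleGraph.vertexMax fun i => (d i + √(d i ^ 2 + 8 * (d i * m i))) / 2] : List ℝ),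
      lamL ≤ B ∧
        (lamL = B ↔ Φ.SwitchingEquivalent (TGainGraph.allNegOne Γ) ∧ lamQ = B)) ∧
    -- the five bounds that are maxima over the edges
    (∀ _ : Nonempty Γ.Dart,
      ∀ B ∈ ([Γ.edgeMax fun i j => d i + d j,
          Γ.edgeMax fun i j => (d i * (d i + m i) + d j * (d j + m j)) / (d i + d j),
          Γ.edgeMax fun i j => √(d i * (d i + m i) + d j * (d j + m j)),
          Γ.edgeMax fun i j => 2 + √(d i * (d i + m i - 4) + d j * (d j + m j - 4) + 4),
          Γ.edgeMax fun i j => (d i + d j + √((d i - d j) ^ 2 + 4 * m i * m j)) / 2] : List ℝ),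
        lamL ≤ B ∧
          (lamL = B ↔ Φ.SwitchingEquivalent (TGainGraph.allNegOne Γ) ∧ lamQ = B)) := by
  obtain rfl : d = fun i => (Γ.degree i : ℝ) := funext hd
  obtain rfl : m = Γ.averageTwoDegree := funext hm
  have hle : lamL ≤ lamQ := by
    rw [hlamL, hlamQ]; exact Φ.largestEigenvalue_laplacian_le
  have hiff : lamL = lamQ ↔ Φ.SwitchingEquivalent (TGainGraph.allNegOne Γ) := by
    rw [hlamL, hlamQ]; exact Φ.largestEigenvalue_laplacian_eq_iff hΓ
  -- If `lamL = B`, then `lamQ` is squeezed between them, so only `lamQ ≤ B` remains for each bound.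
  have transfer : ∀ B, lamQ ≤ B → lamL ≤ B ∧
      (lamL = B ↔ Φ.SwitchingEquivalent (TGainGraph.allNegOne Γ) ∧ lamQ = B) := fun B hB =>
    ⟨hle.trans hB, fun h => ⟨hiff.1 (hle.antisymm (h ▸ hB)), hB.antisymm (h ▸ hle)⟩,
      fun h => (hiff.2 h.1).trans h.2⟩
  obtain ⟨u, hu⟩ := Γ.exists_isSignlessSubsolution
  rw [← hlamQ] at hu
  refine ⟨⟨hle, hiff⟩, fun B hB => transfer B ?_, fun hne B hB => transfer B ?_⟩
  · simp only [List.mem_cons, List.not_mem_nil, or_false] at hB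
    rcases hB with rfl | rfl | rfl | rfl | rfl
    · exact hu.le_two_mul_maxDegree
    · exact hu.le_vertexMax_add hΓ
    · exact hu.le_vertexMax_add_sqrt hΓ
    · exact hu.le_vertexMax_sqrt
    · exact hu.le_vertexMax_half
  · have hnt : Nontrivial V := ⟨hne.some.fst, hne.some.snd, hne.some.adj.ne⟩
    have hpos := fun i => hΓ.preconnected.degree_pos_of_nontrivial i
    simp only [List.mem_cons, List.not_mem_nil, or_false] at hB
    rcases hB with rfl | rfl | rfl | rfl | rfl
    · exact hu.le_edgeMax_add hpos
    · exact hu.le_edgeMax_div hpos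
    · exact hu.le_edgeMax_sqrt hpos
    · exact hu.le_edgeMax_two_add_sqrt hpos
    · exact hu.le_edgeMax_half hpos
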